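/- Let $R$ be a commutative ring and let $\mathrm{Ch}(R)$ be the category of unbounded ($\mathbb{Z}$-graded) chain complexes of $R$-modules, in which the weak equivalences are the quasi-isomorphisms and the fibrations are the degreewise surjective chain maps; two complexes are called weakly equivalent if they are connected by a finite zigzag of quasi-isomorphisms. For chain maps $g\colon X\to Z$ and $h\colon Y\to Z$, factor $g$ as a weak equivalence $X\to X'$ followed by a fibration $X'\to Z$, and $h$ as a weak equivalence $Y\to Y'$ followed by a fibration $Y'\to Z$; a pullback of $X'\to Z\leftarrow Y'$, for any such choice of factorizations, is called a homotopy pullback of $X\to Z\leftarrow Y$. A homotopy fiber of a chain map $f\colon U\to V$ is a homotopy pullback of $U\xrightarrow{f} V\leftarrow 0$. For a chain map $f\colon U\to V$ in $\mathrm{Ch}(R)$, let $\operatorname{hofib}(f)$ be the chain complex with $\operatorname{hofib}(f)_n=U_n\oplus V_{n+1}$ and $d(u,v)=(d(u),\,-f(u)-d(v))$. Then $f$ has a homotopy fiber, and $\operatorname{hofib}(f)$ is weakly equivalent to every homotopy fiber of $f$. -/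

import Mathlib

open CategoryTheory CategoryTheory.Limits
open scoped ZeroObject

universe u v

namespace ChR

variable {R : Type u} [CommRing R]

/-- The differential `(u, v) ↦ (d u, -f u - d v)` from `U (n+1) × V (n+2)` to `U n × V (n+1)`. -/
def hofibD {U V : ChainComplex (ModuleCat.{v} R) ℤ} (f : U ⟶ V) (n : ℤ) :
    (U.X (n + 1) × V.X (n + 1 + 1)) →ₗ[R] (U.X n × V.X (n + 1)) :=
  LinearMap.prod
    ((U.d (n + 1) n).hom ∘ₗ LinearMap.fst R _ _)
    (-((f.f (n + 1)).hom ∘ₗ LinearMap.fst R _ _) -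
      (V.d (n + 1 + 1) (n + 1)).hom ∘ₗ LinearMap.snd R _ _)

theorem hofibD_comp {U V : ChainComplex (ModuleCat.{v} R) ℤ} (f : U ⟶ V) (n : ℤ) :
    ModuleCat.ofHom (hofibD f (n + 1)) ≫ ModuleCat.ofHom (hofibD f n) = 0 := by
  refine ModuleCat.hom_ext (LinearMap.ext fun x => ?_)
  have hU := congrArg (fun g => g.hom x.1) (U.d_comp_d (n + 1 + 1) (n + 1) n)
  have hV := congrArg (fun g => g.hom x.2) (V.d_comp_d (n + 1 + 1 + 1) (n + 1 + 1) (n + 1))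
  have hf := congrArg (fun g => g.hom x.1) (f.comm (n + 1 + 1) (n + 1))
  simp only [ModuleCat.hom_comp, LinearMap.comp_apply, ModuleCat.hom_zero,
    LinearMap.zero_apply] at hU hV hf
  simp [hofibD, hU, hV, hf]

/-- The chain complex `hofib f`, with `U n × V (n+1)` in degree `n` and differential
`d (u, v) = (d u, -f u - d v)`. -/
def hofib {U V : ChainComplex (ModuleCat.{v} R) ℤ} (f : U ⟶ V) :
    ChainComplex (ModuleCat.{v} R) ℤ :=
  ChainComplex.of (fun n => ModuleCat.of R (U.X n × V.X (n + 1)))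
    (fun n => ModuleCat.ofHom (hofibD f n)) (hofibD_comp f)

/-- The fibrations of unbounded chain complexes: the degreewise surjective chain maps.
The weak equivalences are the quasi-isomorphisms, that is, Mathlib's `QuasiIso`. -/
def IsFibration {X Y : ChainComplex (ModuleCat.{v} R) ℤ} (p : X ⟶ Y) : Prop :=
  ∀ n : ℤ, Function.Surjective (p.f n)

/-- Two chain complexes are weakly equivalent if a finite zigzag of quasi-isomorphisms
connects them. -/
def WeaklyEquivalent (X Y : ChainComplex (ModuleCat.{v} R) ℤ) : Prop :=
  Relation.EqvGen (fun A B => ∃ w : A ⟶ B, QuasiIso w) X Y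

/-- A replacement of the chain map `g : X ⟶ Z` by a fibration: a factorization of `g` as a
weak equivalence `i : X ⟶ E` followed by a fibration `p : E ⟶ Z`. -/
structure FibrationReplacement {X Z : ChainComplex (ModuleCat.{v} R) ℤ} (g : X ⟶ Z) where
  E : ChainComplex (ModuleCat.{v} R) ℤ
  i : X ⟶ E
  p : E ⟶ Z
  fac : i ≫ p = g
  weq : QuasiIso i
  fib : IsFibration p

/-- `H` is a homotopy pullback of `X ⟶ Z ⟵ Y`: a pullback of the diagram obtained by
replacing both maps by fibrations. -/
def IsHomotopyPullback {X Y Z : ChainComplex (ModuleCat.{v} R) ℤ} (g : X ⟶ Z) (h : Y ⟶ Z)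
    (H : ChainComplex (ModuleCat.{v} R) ℤ) : Prop :=
  ∃ (G : FibrationReplacement g) (K : FibrationReplacement h) (a : H ⟶ G.E) (b : H ⟶ K.E),
    IsPullback a b G.p K.p

/-- `H` is a homotopy fiber of `f : U ⟶ V`: a homotopy pullback of `U ⟶ V ⟵ 0`. -/
def IsHomotopyFiber {U V : ChainComplex (ModuleCat.{v} R) ℤ} (f : U ⟶ V)
    (H : ChainComplex (ModuleCat.{v} R) ℤ) : Prop :=
  IsHomotopyPullback f (0 : (0 : ChainComplex (ModuleCat.{v} R) ℤ) ⟶ V) H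

end ChR

namespace ChR

variable {R : Type u} [CommRing R] {X Y Z : ChainComplex (ModuleCat.{v} R) ℤ}

/-! Take replacements `p : E ⟶ V` of `f` and `q : K ⟶ V` of `0 ⟶ V`, with pullback `H`. Both `hofib
f` and `H` map to the double mapping path complex of `p` and `q`, whose middle coordinate is a
homotopy between the two images in `V`. The map from `H` is a quasi-isomorphism because `p` is
surjective (`quasiIso_toMappingPath`), the one from `hofib f` because `U ⟶ E` is a quasi-isomorphism
and `K` is acyclic (`quasiIso_hofibToMappingPath`). Taking the identity as second map gives the
factorizations needed for existence. -/

/-! ### Quasi-isomorphisms in terms of elements -/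

theorem d_d_apply (X : ChainComplex (ModuleCat.{v} R) ℤ) (i j k : ℤ) (x : X.X i) :
    X.d j k (X.d i j x) = 0 := by
  rw [← ConcreteCategory.comp_apply, X.d_comp_d]
  rfl

theorem f_d_apply (φ : X ⟶ Y) (i j : ℤ) (x : X.X i) :
    φ.f j (X.d i j x) = Y.d i j (φ.f i x) := by
  rw [← ConcreteCategory.comp_apply, ← φ.comm, ConcreteCategory.comp_apply]

/-- The refinement criterion, applied to the universal module of pairs `(x, y)`, yields the
elementwise one. Conversely, the module of all solutions surjects onto the test object, which avoids
choosing a linear lift. -/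
theorem mono_homologyMap_iff_elements (φ : X ⟶ Y) (n : ℤ) :
    Mono (HomologicalComplex.homologyMap φ (n + 1)) ↔
      ∀ x : X.X (n + 1), X.d (n + 1) n x = 0 → ∀ y : Y.X (n + 1 + 1),
        φ.f (n + 1) x = Y.d (n + 1 + 1) (n + 1) y →
          ∃ x' : X.X (n + 1 + 1), x = X.d (n + 1 + 1) (n + 1) x' := by
  rw [HomologicalComplex.mono_homologyMap_iff_up_to_refinements φ (n + 1 + 1) (n + 1) n
    (by simp) (by simp)]
  constructor
  · intro H x hx y hy
    let A : Submodule R (X.X (n + 1) × Y.X (n + 1 + 1)) :=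
      LinearMap.ker ((X.d (n + 1) n).hom ∘ₗ LinearMap.fst R _ _) ⊓
      LinearMap.ker ((φ.f (n + 1)).hom ∘ₗ LinearMap.fst R _ _ -
        (Y.d (n + 1 + 1) (n + 1)).hom ∘ₗ LinearMap.snd R _ _)
    obtain ⟨A', π, hπ, x₁, h⟩ := H (A := ModuleCat.of R A)
      (ModuleCat.ofHom (LinearMap.fst R _ _ ∘ₗ A.subtype))
      (by ext a; exact a.2.1)
      (ModuleCat.ofHom (LinearMap.snd R _ _ ∘ₗ A.subtype))
      (by ext a; exact sub_eq_zero.1 a.2.2)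
    obtain ⟨a, ha⟩ := (ModuleCat.epi_iff_surjective π).1 hπ ⟨(x, y), hx, sub_eq_zero.2 hy⟩
    refine ⟨x₁ a, ?_⟩
    have := ConcreteCategory.congr_hom h a
    rw [ConcreteCategory.comp_apply, ConcreteCategory.comp_apply, ha] at this
    exact this
  · intro H A x₂ hx₂ y₁ hy
    let B : Submodule R (A × X.X (n + 1 + 1)) :=
      LinearMap.ker (x₂.hom ∘ₗ LinearMap.fst R _ _ -
        (X.d (n + 1 + 1) (n + 1)).hom ∘ₗ LinearMap.snd R _ _)
    refine ⟨ModuleCat.of R B, ModuleCat.ofHom (LinearMap.fst R _ _ ∘ₗ B.subtype), ?_,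
      ModuleCat.ofHom (LinearMap.snd R _ _ ∘ₗ B.subtype), ?_⟩
    · refine (ModuleCat.epi_iff_surjective _).2 fun a => ?_
      obtain ⟨x', hx'⟩ := H (x₂ a) (ConcreteCategory.congr_hom hx₂ a) (y₁ a)
        (ConcreteCategory.congr_hom hy a)
      exact ⟨⟨(a, x'), sub_eq_zero.2 hx'⟩, rfl⟩
    · ext b
      exact sub_eq_zero.1 b.2

theorem epi_homologyMap_iff_elements (φ : X ⟶ Y) (n : ℤ) :
    Epi (HomologicalComplex.homologyMap φ (n + 1)) ↔
      ∀ y : Y.X (n + 1), Y.d (n + 1) n y = 0 →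
        ∃ x : X.X (n + 1), X.d (n + 1) n x = 0 ∧
          ∃ y' : Y.X (n + 1 + 1), y = φ.f (n + 1) x + Y.d (n + 1 + 1) (n + 1) y' := by
  rw [HomologicalComplex.epi_homologyMap_iff_up_to_refinements φ (n + 1 + 1) (n + 1) n
    (by simp) (by simp)]
  constructor
  · intro H y hy
    let A : Submodule R (Y.X (n + 1)) := LinearMap.ker (Y.d (n + 1) n).hom
    obtain ⟨A', π, hπ, x₂, hx₂, y₁, h⟩ := H (A := ModuleCat.of R A)
      (ModuleCat.ofHom A.subtype) (by ext a; exact a.2)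
    obtain ⟨a, ha⟩ := (ModuleCat.epi_iff_surjective π).1 hπ ⟨y, hy⟩
    refine ⟨x₂ a, ConcreteCategory.congr_hom hx₂ a, y₁ a, ?_⟩
    have := ConcreteCategory.congr_hom h a
    rw [ConcreteCategory.comp_apply, ha] at this
    exact this
  · intro H A y₂ hy₂
    let B : Submodule R (A × X.X (n + 1) × Y.X (n + 1 + 1)) :=
      LinearMap.ker ((X.d (n + 1) n).hom ∘ₗ LinearMap.fst R _ _ ∘ₗ LinearMap.snd R _ _) ⊓
      LinearMap.ker (y₂.hom ∘ₗ LinearMap.fst R _ _ -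
        ((φ.f (n + 1)).hom ∘ₗ LinearMap.fst R _ _ ∘ₗ LinearMap.snd R _ _ +
        (Y.d (n + 1 + 1) (n + 1)).hom ∘ₗ LinearMap.snd R _ _ ∘ₗ LinearMap.snd R _ _))
    refine ⟨ModuleCat.of R B, ModuleCat.ofHom (LinearMap.fst R _ _ ∘ₗ B.subtype), ?_,
      ModuleCat.ofHom (LinearMap.fst R _ _ ∘ₗ LinearMap.snd R _ _ ∘ₗ B.subtype), ?_,
      ModuleCat.ofHom (LinearMap.snd R _ _ ∘ₗ LinearMap.snd R _ _ ∘ₗ B.subtype), ?_⟩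
    · refine (ModuleCat.epi_iff_surjective _).2 fun a => ?_
      obtain ⟨x, hx, y', h⟩ := H (y₂ a) (ConcreteCategory.congr_hom hy₂ a)
      exact ⟨⟨(a, x, y'), hx, sub_eq_zero.2 h⟩, rfl⟩
    · ext b
      exact b.2.1
    · ext b
      exact sub_eq_zero.1 b.2.2

/-- A chain map is a quasi-isomorphism if and only if it is bijective on homology classes,
expressed through cycles and boundaries. -/
theorem quasiIso_iff_elements (φ : X ⟶ Y) :
    QuasiIso φ ↔ ∀ n : ℤ,
      (∀ x : X.X (n + 1), X.d (n + 1) n x = 0 → ∀ y : Y.X (n + 1 + 1),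
        φ.f (n + 1) x = Y.d (n + 1 + 1) (n + 1) y →
          ∃ x' : X.X (n + 1 + 1), x = X.d (n + 1 + 1) (n + 1) x') ∧
      (∀ y : Y.X (n + 1), Y.d (n + 1) n y = 0 →
        ∃ x : X.X (n + 1), X.d (n + 1) n x = 0 ∧
          ∃ y' : Y.X (n + 1 + 1), y = φ.f (n + 1) x + Y.d (n + 1 + 1) (n + 1) y') := by
  simp_rw [← mono_homologyMap_iff_elements, ← epi_homologyMap_iff_elements, quasiIso_iff,
    quasiIsoAt_iff_isIso_homologyMap]
  constructor
  · intro H n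
    have := H (n + 1)
    exact ⟨inferInstance, inferInstance⟩
  · intro H n
    obtain ⟨m, rfl⟩ : ∃ m, n = m + 1 := ⟨n - 1, by ring⟩
    have := (H m).1
    have := (H m).2
    exact isIso_of_mono_of_epi _

/-- Surjectivity of `0 ⟶ K` on homology makes every cycle of `K` a boundary. -/
theorem exists_eq_d_of_quasiIso_zero {K : ChainComplex (ModuleCat.{v} R) ℤ}
    (j : (0 : ChainComplex (ModuleCat.{v} R) ℤ) ⟶ K) (hj : QuasiIso j) (n : ℤ)
    (k : K.X (n + 1)) (hk : K.d (n + 1) n k = 0) :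
    ∃ k' : K.X (n + 1 + 1), k = K.d (n + 1 + 1) (n + 1) k' := by
  obtain ⟨x, -, k', h⟩ := ((quasiIso_iff_elements j).1 hj n).2 k hk
  obtain rfl : j = 0 := (isZero_zero _).eq_of_src _ _
  exact ⟨k', by simpa using h⟩

/-! ### The double mapping path complex and its maps -/

/-- The differential `(x, z, y) ↦ (d x, h y - g x - d z, d y)` of the double mapping path
complex. -/
def mappingPathD (g : X ⟶ Z) (h : Y ⟶ Z) (n : ℤ) :
    (X.X (n + 1) × Z.X (n + 1 + 1) × Y.X (n + 1)) →ₗ[R] (X.X n × Z.X (n + 1) × Y.X n) :=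
  LinearMap.prod
    ((X.d (n + 1) n).hom ∘ₗ LinearMap.fst R _ _)
    (LinearMap.prod
      ((h.f (n + 1)).hom ∘ₗ LinearMap.snd R _ _ ∘ₗ LinearMap.snd R _ _ -
        (g.f (n + 1)).hom ∘ₗ LinearMap.fst R _ _ -
        (Z.d (n + 1 + 1) (n + 1)).hom ∘ₗ LinearMap.fst R _ _ ∘ₗ LinearMap.snd R _ _)
      ((Y.d (n + 1) n).hom ∘ₗ LinearMap.snd R _ _ ∘ₗ LinearMap.snd R _ _))

theorem mappingPathD_apply (g : X ⟶ Z) (h : Y ⟶ Z) (n : ℤ) (x : X.X (n + 1))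
    (z : Z.X (n + 1 + 1)) (y : Y.X (n + 1)) :
    mappingPathD g h n (x, z, y) =
      (X.d (n + 1) n x, h.f (n + 1) y - g.f (n + 1) x - Z.d (n + 1 + 1) (n + 1) z,
        Y.d (n + 1) n y) :=
  rfl

theorem mappingPathD_comp (g : X ⟶ Z) (h : Y ⟶ Z) (n : ℤ) :
    ModuleCat.ofHom (mappingPathD g h (n + 1)) ≫ ModuleCat.ofHom (mappingPathD g h n) = 0 := by
  refine ModuleCat.hom_ext (LinearMap.ext fun ⟨x, z, y⟩ => ?_)
  change mappingPathD g h n (mappingPathD g h (n + 1) (x, z, y)) = 0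
  simp only [mappingPathD_apply, d_d_apply, f_d_apply, map_sub]
  simp

/-- The double mapping path complex of `X ⟶ Z ⟵ Y`, with `X n × Z (n+1) × Y n` in degree `n`. -/
def mappingPath (g : X ⟶ Z) (h : Y ⟶ Z) : ChainComplex (ModuleCat.{v} R) ℤ :=
  ChainComplex.of (fun n => ModuleCat.of R (X.X n × Z.X (n + 1) × Y.X n))
    (fun n => ModuleCat.ofHom (mappingPathD g h n)) (mappingPathD_comp g h)

theorem mappingPath_d (g : X ⟶ Z) (h : Y ⟶ Z) (n : ℤ) :
    (mappingPath g h).d (n + 1) n = ModuleCat.ofHom (mappingPathD g h n) :=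
  ChainComplex.of_d (fun n => ModuleCat.of R (X.X n × Z.X (n + 1) × Y.X n))
    (fun n => ModuleCat.ofHom (mappingPathD g h n)) n

theorem mappingPath_d_apply (g : X ⟶ Z) (h : Y ⟶ Z) (n : ℤ) (x : X.X (n + 1))
    (z : Z.X (n + 1 + 1)) (y : Y.X (n + 1)) :
    (mappingPath g h).d (n + 1) n (x, z, y) =
      ((X.d (n + 1) n x, h.f (n + 1) y - g.f (n + 1) x - Z.d (n + 1 + 1) (n + 1) z,
        Y.d (n + 1) n y) : X.X n × Z.X (n + 1) × Y.X n) := by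
  rw [mappingPath_d]
  rfl

theorem hofib_d_apply (f : X ⟶ Y) (n : ℤ) (x : X.X (n + 1)) (y : Y.X (n + 1 + 1)) :
    (hofib f).d (n + 1) n (x, y) =
      ((X.d (n + 1) n x, -f.f (n + 1) x - Y.d (n + 1 + 1) (n + 1) y) :
        X.X n × Y.X (n + 1)) := by
  rw [show (hofib f).d (n + 1) n = ModuleCat.ofHom (hofibD f n) from
    ChainComplex.of_d (fun n => ModuleCat.of R (X.X n × Y.X (n + 1)))
      (fun n => ModuleCat.ofHom (hofibD f n)) n]
  rfl

/-- The terms of `hofib f` are products only after unfolding, so componentwise comparison is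
restated for them. -/
theorem hofib_mk_eq_zero {f : X ⟶ Y} {n : ℤ} {x : X.X n} {y : Y.X (n + 1)}
    (e : ((x, y) : X.X n × Y.X (n + 1)) = (0 : (hofib f).X n)) : x = 0 ∧ y = 0 :=
  Prod.mk_eq_zero.1 e

theorem mappingPath_mk_eq_zero {g : X ⟶ Z} {h : Y ⟶ Z} {n : ℤ} {x : X.X n} {z : Z.X (n + 1)}
    {y : Y.X n} (e : ((x, z, y) : X.X n × Z.X (n + 1) × Y.X n) = (0 : (mappingPath g h).X n)) :
    x = 0 ∧ z = 0 ∧ y = 0 :=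
  have e' := Prod.mk_eq_zero.1 e
  ⟨e'.1, Prod.mk_eq_zero.1 e'.2⟩

theorem mappingPath_mk_inj {g : X ⟶ Z} {h : Y ⟶ Z} {n : ℤ} {x x' : X.X n} {z z' : Z.X (n + 1)}
    {y y' : Y.X n} (e : @Eq ((mappingPath g h).X n) (x, z, y) (x', z', y')) :
    x = x' ∧ z = z' ∧ y = y' :=
  have e' := Prod.mk.inj e
  ⟨e'.1, Prod.mk.inj e'.2⟩

theorem mappingPath_mk_eq_add {g : X ⟶ Z} {h : Y ⟶ Z} {n : ℤ} {x x' x'' : X.X n}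
    {z z' z'' : Z.X (n + 1)} {y y' y'' : Y.X n} (hx : x = x' + x'') (hz : z = z' + z'')
    (hy : y = y' + y'') :
    ((x, z, y) : X.X n × Z.X (n + 1) × Y.X n) =
      (HAdd.hAdd (α := (mappingPath g h).X n) (β := (mappingPath g h).X n)
        (x', z', y') (x'', z'', y'')) := by
  subst hx hz hy
  rfl

/-- Chain maps out of degreewise linear maps compatible with the differentials on elements. -/
def homOfLinear (φ : ∀ n, X.X n →ₗ[R] Y.X n)
    (hφ : ∀ (n : ℤ) (x : X.X (n + 1)), φ n (X.d (n + 1) n x) = Y.d (n + 1) n (φ (n + 1) x)) :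
    X ⟶ Y where
  f n := ModuleCat.ofHom (φ n)
  comm' i j hij := by
    obtain rfl : j + 1 = i := hij
    ext x
    exact (hφ j x).symm

/-- The projection of the double mapping path complex to its last factor. -/
def mappingPathSnd (g : X ⟶ Z) (h : Y ⟶ Z) : mappingPath g h ⟶ Y :=
  homOfLinear (fun n => (LinearMap.snd R _ _ ∘ₗ LinearMap.snd R (X.X n) (Z.X (n + 1) × Y.X n) :))
    fun n ⟨x, z, y⟩ => by
      rw [mappingPath_d_apply]
      rfl

/-- The map `x ↦ (a x, 0, b x)` to the double mapping path complex induced by a commutative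
square. -/
def toMappingPath {H : ChainComplex (ModuleCat.{v} R) ℤ} (g : X ⟶ Z) (h : Y ⟶ Z)
    (a : H ⟶ X) (b : H ⟶ Y) (w : a ≫ g = b ≫ h) : H ⟶ mappingPath g h :=
  homOfLinear (fun n => (a.f n).hom.prod (LinearMap.prod (0 : H.X n →ₗ[R] Z.X (n + 1)) (b.f n).hom))
    fun n x => by
      have hw : g.f (n + 1) (a.f (n + 1) x) = h.f (n + 1) (b.f (n + 1) x) :=
        ConcreteCategory.congr_hom (HomologicalComplex.congr_hom w (n + 1)) x
      refine Eq.trans ?_ (mappingPath_d_apply g h n (a.f (n + 1) x) 0 (b.f (n + 1) x)).symm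
      refine Prod.ext (f_d_apply a _ _ x) (Prod.ext ?_ (f_d_apply b _ _ x))
      change 0 = h.f (n + 1) (b.f (n + 1) x) - g.f (n + 1) (a.f (n + 1) x) - Z.d _ _ 0
      rw [hw, sub_self, map_zero, sub_zero]

theorem toMappingPath_f_apply {H : ChainComplex (ModuleCat.{v} R) ℤ} (g : X ⟶ Z) (h : Y ⟶ Z)
    (a : H ⟶ X) (b : H ⟶ Y) (w : a ≫ g = b ≫ h) (n : ℤ) (x : H.X n) :
    (toMappingPath g h a b w).f n x =
      ((a.f n x, 0, b.f n x) : X.X n × Z.X (n + 1) × Y.X n) :=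
  rfl

/-- The map `(x, z) ↦ (i x, z, 0)` from `hofib f` to the double mapping path complex of a
factorization of `f`. -/
def hofibToMappingPath {E : ChainComplex (ModuleCat.{v} R) ℤ} (f : X ⟶ Z) (i : X ⟶ E)
    (p : E ⟶ Z) (q : Y ⟶ Z) (fac : i ≫ p = f) : hofib f ⟶ mappingPath p q :=
  homOfLinear (fun n => LinearMap.prod ((i.f n).hom ∘ₗ LinearMap.fst R (X.X n) (Z.X (n + 1)))
      (LinearMap.prod (LinearMap.snd R (X.X n) (Z.X (n + 1))) (0 : _ →ₗ[R] Y.X n)))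
    fun n ⟨x, z⟩ => by
      rw [hofib_d_apply]
      refine Eq.trans ?_ (mappingPath_d_apply p q n (i.f (n + 1) x) z 0).symm
      subst fac
      refine Prod.ext (f_d_apply i _ _ x) (Prod.ext ?_ ?_)
      · change -p.f (n + 1) (i.f (n + 1) x) - Z.d _ _ z =
          q.f (n + 1) 0 - p.f (n + 1) (i.f (n + 1) x) - Z.d _ _ z
        rw [map_zero, zero_sub]
      · exact (map_zero (Y.d (n + 1) n).hom).symm

theorem hofibToMappingPath_f_apply {E : ChainComplex (ModuleCat.{v} R) ℤ} (f : X ⟶ Z)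
    (i : X ⟶ E) (p : E ⟶ Z) (q : Y ⟶ Z) (fac : i ≫ p = f) (n : ℤ) (x : X.X n)
    (z : Z.X (n + 1)) :
    (hofibToMappingPath f i p q fac).f n (x, z) =
      ((i.f n x, z, 0) : E.X n × Z.X (n + 1) × Y.X n) :=
  rfl

/-! ### The two comparison quasi-isomorphisms -/

/-- The pullback of a fibration maps quasi-isomorphically to the double mapping path complex. -/
theorem quasiIso_toMappingPath {H : ChainComplex (ModuleCat.{v} R) ℤ} {g : X ⟶ Z} {h : Y ⟶ Z}
    {a : H ⟶ X} {b : H ⟶ Y} (sq : IsPullback a b g h) (hg : IsFibration g) :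
    QuasiIso (toMappingPath g h a b sq.w) := by
  -- Evaluation in degree `n` and the forgetful functor preserve pullbacks, so elements of `H.X n`
  -- are the compatible pairs.
  have ext : ∀ n (s t : H.X n), a.f n s = a.f n t → b.f n s = b.f n t → s = t :=
    fun n s t h₁ h₂ => Types.ext_of_isPullback
      (sq.map (HomologicalComplex.eval _ _ n ⋙ forget (ModuleCat R))) h₁ h₂
  have lift : ∀ n (x : X.X n) (y : Y.X n), g.f n x = h.f n y →
      ∃ s : H.X n, a.f n s = x ∧ b.f n s = y :=
    fun n x y e => Types.exists_of_isPullback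
      (sq.map (HomologicalComplex.eval _ _ n ⋙ forget (ModuleCat R))) x y e
  refine (quasiIso_iff_elements _).2 fun n => ⟨?_, ?_⟩
  · rintro s hs ⟨x, z, y⟩ e
    rw [toMappingPath_f_apply, mappingPath_d_apply] at e
    obtain ⟨e₁, e₂, e₃⟩ := mappingPath_mk_inj e
    -- Lifting `z` to `x'` absorbs the homotopy: `g (x + d x') = g x + d z = h y`.
    obtain ⟨x', hx'⟩ := hg _ z
    obtain ⟨s', h₁, h₂⟩ := lift _ (x + X.d _ _ x') y (by
      rw [map_add, f_d_apply, hx', ← sub_eq_zero, ← neg_eq_zero, e₂]; abel)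
    refine ⟨s', ext _ _ _ ?_ ?_⟩
    · rw [f_d_apply, h₁, map_add, d_d_apply, add_zero, e₁]
    · rw [f_d_apply, h₂, e₃]
  · rintro ⟨x, z, y⟩ e
    rw [mappingPath_d_apply] at e
    obtain ⟨e₁, e₂, e₃⟩  := mappingPath_mk_eq_zero e
    obtain ⟨x', hx'⟩ := hg _ z
    obtain ⟨s, h₁, h₂⟩ := lift _ (x + X.d _ _ x') y (by
      rw [map_add, f_d_apply, hx', ← sub_eq_zero, ← neg_eq_zero, ← e₂]; abel)
    -- Here `d (-x', 0, 0) = (-d x', z, 0)`.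
    refine ⟨s, ext _ _ _ ?_ ?_, (-x', 0, 0), ?_⟩
    · rw [f_d_apply, h₁, map_add, d_d_apply, add_zero, e₁, map_zero]
    · rw [f_d_apply, h₂, e₃, map_zero]
    · rw [toMappingPath_f_apply, mappingPath_d_apply, h₁, h₂]
      refine mappingPath_mk_eq_add ?_ ?_ ?_ <;> simp [hx']

/-- If `i` is a quasi-isomorphism and `Y` is acyclic, then `hofib (i ≫ p)` maps
quasi-isomorphically to the double mapping path complex of `p` and `q : Y ⟶ Z`. -/
theorem quasiIso_hofibToMappingPath {E : ChainComplex (ModuleCat.{v} R) ℤ} (f : X ⟶ Z)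
    (i : X ⟶ E) (p : E ⟶ Z) (q : Y ⟶ Z) (fac : i ≫ p = f) (hi : QuasiIso i)
    (hY : ∀ (n : ℤ) (y : Y.X (n + 1)), Y.d (n + 1) n y = 0 →
      ∃ y' : Y.X (n + 1 + 1), y = Y.d (n + 1 + 1) (n + 1) y') :
    QuasiIso (hofibToMappingPath f i p q fac) := by
  have hf : ∀ n (x : X.X n), f.f n x = p.f n (i.f n x) := by
    subst fac
    intro n x
    rfl
  rw [quasiIso_iff_elements] at hi ⊢
  refine fun n => ⟨?_, ?_⟩
  · rintro ⟨x, z⟩ hx ⟨e, w, y⟩ h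
    rw [hofib_d_apply] at hx
    rw [hofibToMappingPath_f_apply, mappingPath_d_apply] at h
    obtain ⟨hx₁, -⟩  := hofib_mk_eq_zero hx
    obtain ⟨h₁, h₂, h₃⟩ := mappingPath_mk_inj h
    obtain ⟨y', rfl⟩ := hY _ y h₃.symm
    obtain ⟨x', rfl⟩ := (hi n).1 x hx₁ e h₁
    rw [f_d_apply] at h₁
    -- `i x' - e` is a cycle, hence `i x'' + d e'` for a cycle `x''`; subtracting `x''` from `x'`
    -- corrects the primitive.
    obtain ⟨x'', hx'', e', he'⟩ := (hi (n + 1)).2 (i.f _ x' - e) (by rw [map_sub, h₁, sub_self])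
    refine ⟨(x' - x'', w - q.f _ y' - p.f _ e'), ?_⟩
    rw [hofib_d_apply]
    refine Prod.ext ?_ ?_
    · simp [hx'']
    · have hE : e = i.f _ x' - i.f _ x'' - E.d _ _ e' := by
        rw [sub_sub, ← he', sub_sub_cancel]
      simp only [h₂, hE, map_sub, hf, f_d_apply]
      abel
  · rintro ⟨e, z, y⟩ h
    rw [mappingPath_d_apply] at h
    obtain ⟨h₁, h₂, h₃⟩  := mappingPath_mk_eq_zero h
    obtain ⟨y', rfl⟩ := hY _ y h₃
    obtain ⟨x, hx, e', rfl⟩ := (hi n).2 e h₁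
    -- Subtracting `d (e', 0, y') = (d e', q y' - p e', d y')` kills the last coordinate and leaves
    -- `i x` in the first.
    refine ⟨(x, z + p.f _ e' - q.f _ y'), ?_, (e', 0, y'), ?_⟩
    · rw [hofib_d_apply]
      refine Prod.ext hx ?_
      simp only [map_add, f_d_apply] at h₂
      simp only [map_add, map_sub, hf]
      refine Eq.trans ?_ h₂
      abel
    · rw [hofibToMappingPath_f_apply, mappingPath_d_apply]
      refine mappingPath_mk_eq_add ?_ ?_ ?_ <;> simp

/-! ### Existence of homotopy pullbacks and conclusion -/

/-- The factorization of a chain map through its mapping path complex. -/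
def mappingPathReplacement (g : X ⟶ Z) : FibrationReplacement g where
  E := mappingPath g (𝟙 Z)
  i := toMappingPath g (𝟙 Z) (𝟙 X) g (by simp)
  p := mappingPathSnd g (𝟙 Z)
  fac := by
    ext n x
    rfl
  weq := by
    refine (quasiIso_iff_elements _).2 fun n => ⟨?_, ?_⟩
    · rintro x - ⟨x', z, y⟩ h
      rw [toMappingPath_f_apply, mappingPath_d_apply] at h
      exact ⟨x', congrArg Prod.fst h⟩
    · rintro ⟨x, z, y⟩ h
      rw [mappingPath_d_apply] at h
      obtain ⟨h₁, h₂, h₃⟩  := mappingPath_mk_eq_zero h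
      -- Here `d (0, 0, z) = (0, z, d z)`, and the cycle condition says `y = g x + d z`.
      refine ⟨x, h₁, (0, 0, z), ?_⟩
      rw [toMappingPath_f_apply, mappingPath_d_apply]
      refine mappingPath_mk_eq_add ?_ ?_ ?_
      · simp
      · simp
      · simp only [HomologicalComplex.id_f, ModuleCat.id_apply] at h₂
        exact (sub_eq_iff_eq_add'.1 (sub_eq_zero.1 h₂))
  fib n z := ⟨((0, 0, z) : X.X n × Z.X (n + 1) × Z.X n), rfl⟩

theorem exists_isHomotopyPullback (g : X ⟶ Z) (h : Y ⟶ Z) :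
    ∃ H, IsHomotopyPullback g h H :=
  ⟨_, mappingPathReplacement g, mappingPathReplacement h, _, _, IsPullback.of_hasPullback _ _⟩

theorem weaklyEquivalent_hofib_of_isHomotopyFiber (f : X ⟶ Z)
    (H : ChainComplex (ModuleCat.{v} R) ℤ) (hH : IsHomotopyFiber f H) :
    WeaklyEquivalent (hofib f) H := by
  obtain ⟨G, K, a, b, sq⟩ := hH
  exact .trans _ _ _
    (.rel _ _ ⟨_, quasiIso_hofibToMappingPath f G.i G.p K.p G.fac G.weq
      (exists_eq_d_of_quasiIso_zero K.i K.weq)⟩)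
    (.symm _ _ (.rel _ _ ⟨_, quasiIso_toMappingPath sq G.fib⟩))

end ChR

theorem mainTheorem5 {R : Type u} [CommRing R] {U V : ChainComplex (ModuleCat.{v} R) ℤ}
    (f : U ⟶ V) :
    (∃ H : ChainComplex (ModuleCat.{v} R) ℤ, ChR.IsHomotopyFiber f H) ∧
      ∀ H : ChainComplex (ModuleCat.{v} R) ℤ, ChR.IsHomotopyFiber f H →
        ChR.WeaklyEquivalent (ChR.hofib f) H :=
  ⟨ChR.exists_isHomotopyPullback f _, ChR.weaklyEquivalent_hofib_of_isHomotopyFiber f⟩
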